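/- Let $N\ge 1$ and let $\Omega\subset\mathbb R^N$ be a bounded domain (nonempty, connected, open) of class $C^2$. Put $\delta(x)=\operatorname{dist}(x,\partial\Omega)$, let $1<p<\infty$ and let $\alpha\in\mathbb R$ satisfy $\alpha\ge 1-\frac1p$. Then: 1. For every $\eta\in(0,\sup_{x\in\Omega}\delta(x))$, $$\inf\left\{\int_\Omega|\nabla u|^p\,\delta^{\alpha p}\,dx \;:\; u\in C_c^1(\Omega),\ u=1 \text{ on } \{x\in\Omega:\delta(x)=\eta\}\right\}=0 .$$ 2. The weighted Hardy inequality fails: there is no constant $\mu>0$ such that $$\int_\Omega|\nabla u|^p\,\delta^{\alpha p}\,dx\;\ge\;\mu\int_\Omega|u|^p\,\delta^{p(\alpha-1)}\,dx\qquad\text{for all }u\in W^{1,p}_{\alpha,0}(\Omega),$$ where $W^{1,p}_{\alpha,0}(\Omega)$ is the completion of $C_c^\infty(\Omega)$ with respect to the norm $\left(\int_\Omega|\nabla u|^p\delta^{\alpha p}\,dx\right)^{1/p}+\left(\int_\Omega|u|^p\delta^{\alpha p}\,dx\right)^{1/p}$. -/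

import Mathlib

open MeasureTheory Set Filter Topology
open scoped ENNReal ContDiff

noncomputable section

namespace WeightedHardy

/-- A bounded domain (nonempty connected open set) of class `C²` in `ℝᴺ`: near each of its boundary
points it is the sublevel set `{ρ < 0}` of a `C²` function `ρ` whose derivative does not vanish at
that boundary point. -/
structure IsBoundedC2Domain {N : ℕ} (Ω : Set (EuclideanSpace ℝ (Fin N))) : Prop where
  isOpen : IsOpen Ω
  isConnected : IsConnected Ω
  isBounded : Bornology.IsBounded Ω
  boundary_C2 : ∀ x₀ ∈ frontier Ω, ∃ (U : Set (EuclideanSpace ℝ (Fin N)))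
    (ρ : EuclideanSpace ℝ (Fin N) → ℝ), IsOpen U ∧ x₀ ∈ U ∧ ContDiffOn ℝ 2 ρ U ∧
      fderiv ℝ ρ x₀ ≠ 0 ∧ Ω ∩ U = {x ∈ U | ρ x < 0}

/-- The distance `δ(x) = dist(x, ∂Ω)` to the boundary. -/
def bdist {N : ℕ} (Ω : Set (EuclideanSpace ℝ (Fin N))) (x : EuclideanSpace ℝ (Fin N)) : ℝ :=
  Metric.infDist x (frontier Ω)

/-- The space `C_c^k(Ω)` of real-valued `C^k` functions with compact support contained in `Ω`
(extended by zero outside `Ω`). -/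
def CcSpace {N : ℕ} (k : ℕ∞) (Ω : Set (EuclideanSpace ℝ (Fin N))) :
    Set (EuclideanSpace ℝ (Fin N) → ℝ) :=
  {u | ContDiff ℝ k u ∧ HasCompactSupport u ∧ tsupport u ⊆ Ω}

/-- The weighted integral `∫_Ω |f|^p δ^s dx`, with values in `[0, ∞]`. -/
def weightedIntegral {N : ℕ} (Ω : Set (EuclideanSpace ℝ (Fin N))) (p s : ℝ)
    {F : Type*} [NormedAddCommGroup F] (f : EuclideanSpace ℝ (Fin N) → F) : ℝ≥0∞ :=
  ∫⁻ x in Ω, ENNReal.ofReal (‖f x‖ ^ p * bdist Ω x ^ s)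

/-- The norm `‖|∇u|‖_{L^p(Ω, δ^{αp})} + ‖u‖_{L^p(Ω, δ^{αp})}` of a function `u` with
gradient `G`. -/
def sobolevNorm {N : ℕ} (Ω : Set (EuclideanSpace ℝ (Fin N))) (p α : ℝ)
    (u : EuclideanSpace ℝ (Fin N) → ℝ)
    (G : EuclideanSpace ℝ (Fin N) → EuclideanSpace ℝ (Fin N)) : ℝ≥0∞ :=
  weightedIntegral Ω p (α * p) G ^ (1 / p) + weightedIntegral Ω p (α * p) u ^ (1 / p)

/-- `MemW0 Ω p α u G`: the function `u` belongs to `W^{1,p}_{α,0}(Ω)` and `∇u = G`.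
The completion of `C_c^∞(Ω)` for the norm above is realized as the closure of the set of pairs
`(φ, ∇φ)`, `φ ∈ C_c^∞(Ω)`, in `L^p(Ω, δ^{αp}) × L^p(Ω, δ^{αp}; ℝᴺ)`. As `δ^{αp}` is bounded above
and away from zero on compact subsets of `Ω`, `G` is the weak gradient of `u` in `Ω`, so `u`
determines it almost everywhere. -/
def MemW0 {N : ℕ} (Ω : Set (EuclideanSpace ℝ (Fin N))) (p α : ℝ)
    (u : EuclideanSpace ℝ (Fin N) → ℝ)
    (G : EuclideanSpace ℝ (Fin N) → EuclideanSpace ℝ (Fin N)) : Prop :=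
  AEStronglyMeasurable u (volume.restrict Ω) ∧ AEStronglyMeasurable G (volume.restrict Ω) ∧
  ∃ φ : ℕ → EuclideanSpace ℝ (Fin N) → ℝ, (∀ k, φ k ∈ CcSpace ⊤ Ω) ∧
    Tendsto (fun k => sobolevNorm Ω p α (u - φ k) (G - gradient (φ k))) atTop (𝓝 0)

/-- The weighted Hardy inequality: there is `μ > 0` such that
`∫_Ω |∇u|^p δ^{αp} ≥ μ ∫_Ω |u|^p δ^{p(α-1)}` for every `u ∈ W^{1,p}_{α,0}(Ω)`. -/
def HardyInequality {N : ℕ} (Ω : Set (EuclideanSpace ℝ (Fin N))) (p α : ℝ) : Prop :=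
  ∃ μ : ℝ, 0 < μ ∧ ∀ u G, MemW0 Ω p α u G →
    ENNReal.ofReal μ * weightedIntegral Ω p (p * (α - 1)) u ≤ weightedIntegral Ω p (α * p) G

end WeightedHardy

end

/-! A cutoff rising from 0 to 1 in the layer `t/2 < δ < t` has gradient `O(1/t)`, and the layer has
volume `O(t)` because the boundary is locally a regular zero set. Its energy is thus `O(t ^ (αp - p
+ 1))`, which is bounded for `t ≤ 1` as `α ≥ 1 - 1/p`, but need not be small when equality holds.
Averaging the cutoffs at `n` dyadic scales gives smallness: the layers are disjoint, so the energy
is at most `n · O(n ^ (-p))`, which tends to 0 since `p > 1` (`exists_energy_le`). These averages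
equal 1 wherever `δ ≥ η`, so the infimum is 0; they also refute Hardy's inequality, whose other side
stays bounded below. -/

namespace WeightedHardy

/-! ### Volume of neighbourhoods of a regular zero set -/

section Thickening

variable {E : Type*} [NormedAddCommGroup E] [NormedSpace ℝ E] [FiniteDimensional ℝ E]
  [MeasurableSpace E] [BorelSpace E]

/-- If the pairs of points of `F` whose difference is `2t`-close to a multiple `τ • v` only occur
for `τ ≤ K * t`, then the `t`-neighbourhoods of `F` have measure `O(t)`: many translates of such a
neighbourhood in the direction `v` are pairwise disjoint. -/
theorem measure_thickening_le_of_transversal (μ : Measure E) [μ.IsAddHaarMeasure] {F : Set E}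
    (hF : Bornology.IsBounded F) (v : E) {K : ℝ} (hK : 0 < K)
    (h : ∀ y ∈ F, ∀ z ∈ F, ∀ t : ℝ, 0 < t → ∀ τ : ℝ, 0 ≤ τ →
      ‖z - y - τ • v‖ ≤ 2 * t → τ ≤ K * t) :
    ∃ C : ℝ≥0∞, C ≠ ⊤ ∧ ∀ t : ℝ, 0 < t → t ≤ 1 →
      μ (Metric.thickening t F) ≤ C * ENNReal.ofReal t := by
  -- About `1/t` translates with spacing `2Kt` shift by at most `2K‖v‖` in all; the 1 absorbs the
  -- radius `t`. Spacing `2Kt` exceeds the permitted `Kt`, so the translates are disjoint.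
  set R : ℝ := 1 + 2 * K * ‖v‖ with hR
  refine ⟨μ (Metric.thickening R F), (hF.thickening.measure_lt_top).ne, fun t ht ht1 => ?_⟩
  set M : ℕ := ⌈1 / t⌉₊ with hM
  set T := Metric.thickening t F with hT
  let A : ℕ → Set E := fun k => (fun x => x + (-((k : ℝ) * (2 * K * t)) • v)) ⁻¹' T
  have hA : ∀ k, μ (A k) = μ T := fun k => measure_preimage_add_right μ _ T
  have hmeas : ∀ k, MeasurableSet (A k) := fun k =>
    (Metric.isOpen_thickening.preimage (by fun_prop)).measurableSet
  have hlt : ∀ k l : ℕ, k < l → Disjoint (A k) (A l) := by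
    intro k l hkl
    rw [Set.disjoint_left]
    intro x hxk hxl
    obtain ⟨z, hz, hxz⟩ := Metric.mem_thickening_iff.1 hxk
    obtain ⟨y, hy, hxy⟩ := Metric.mem_thickening_iff.1 hxl
    have hkl' : (1 : ℝ) ≤ (l : ℝ) - k := by
      have : (k : ℝ) + 1 ≤ l := by exact_mod_cast hkl
      linarith
    have hKt : 0 < K * t := mul_pos hK ht
    have := h y hy z hz t ht (((l : ℝ) - k) * (2 * K * t)) (by nlinarith) (by
      rw [dist_eq_norm] at hxz hxy
      have e : z - y - (((l : ℝ) - k) * (2 * K * t)) • v =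
          (x + (-((l : ℝ) * (2 * K * t)) • v) - y) -
            (x + (-((k : ℝ) * (2 * K * t)) • v) - z) := by
        rw [sub_mul, sub_smul, neg_smul, neg_smul]
        abel
      rw [e]
      refine (norm_sub_le _ _).trans (by linarith))
    nlinarith
  have hdisj : Set.PairwiseDisjoint (↑(Finset.range M) : Set ℕ) A := by
    intro k _ l _ hkl
    rcases lt_or_gt_of_ne hkl with h' | h'
    · exact hlt k l h'
    · exact (hlt l k h').symm
  have hsub : (⋃ k ∈ Finset.range M, A k) ⊆ Metric.thickening R F := by
    intro x hx
    simp only [mem_iUnion, Finset.mem_range, exists_prop] at hx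
    obtain ⟨k, hk, hx⟩ := hx
    have hxT : x + (-((k : ℝ) * (2 * K * t)) • v) ∈ T := hx
    obtain ⟨z, hz, hxz⟩ := Metric.mem_thickening_iff.1 hxT
    refine Metric.mem_thickening_iff.2 ⟨z, hz, ?_⟩
    have hk' : (k : ℝ) * t < 1 := by
      have := Nat.lt_ceil.1 hk
      rwa [lt_div_iff₀ ht] at this
    rw [dist_eq_norm] at hxz ⊢
    have e : x - z = (x + (-((k : ℝ) * (2 * K * t)) • v) - z) +
        ((k : ℝ) * (2 * K * t)) • v := by
      rw [neg_smul]
      abel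
    rw [e]
    refine (norm_add_le _ _).trans_lt ?_
    rw [norm_smul, Real.norm_of_nonneg (by positivity)]
    have : (k : ℝ) * (2 * K * t) * ‖v‖ ≤ 2 * K * ‖v‖ := by
      have : (k : ℝ) * (2 * K * t) * ‖v‖ = (k * t) * (2 * K * ‖v‖) := by ring
      rw [this]
      exact mul_le_of_le_one_left (by positivity) hk'.le
    linarith
  have hmain : (M : ℝ≥0∞) * μ T ≤ μ (Metric.thickening R F) := by
    refine le_trans (le_of_eq ?_) (measure_mono hsub)
    rw [measure_biUnion_finset hdisj fun k _ => hmeas k]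
    simp [hA]
  have hMt : (1 : ℝ≥0∞) ≤ M * ENNReal.ofReal t := by
    rw [← ENNReal.ofReal_natCast, ← ENNReal.ofReal_mul (by positivity), ENNReal.one_le_ofReal]
    have := Nat.le_ceil (1 / t)
    rwa [div_le_iff₀ ht] at this
  calc μ T = 1 * μ T := (one_mul _).symm
    _ ≤ (M * ENNReal.ofReal t) * μ T := by gcongr
    _ = (M * μ T) * ENNReal.ofReal t := by ring
    _ ≤ _ := by gcongr

/-- A set on which a function with nonzero strict derivative vanishes has, near the given point,
neighbourhoods of measure `O(t)`. -/
theorem measure_thickening_le_of_hasStrictFDerivAt (μ : Measure E) [μ.IsAddHaarMeasure]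
    {S : Set E} {ρ : E → ℝ} {ρ' : E →L[ℝ] ℝ} {x₀ : E} (hρ : HasStrictFDerivAt ρ ρ' x₀)
    (hρ' : ρ' ≠ 0) (hS : ∀ᶠ x in 𝓝 x₀, x ∈ S → ρ x = 0) :
    ∃ V ∈ 𝓝 x₀, ∃ C : ℝ≥0∞, C ≠ ⊤ ∧ ∀ t : ℝ, 0 < t → t ≤ 1 →
      μ (Metric.thickening t (S ∩ V)) ≤ C * ENNReal.ofReal t := by
  obtain ⟨v, hv⟩ : ∃ v, ρ' v = 1 := by
    obtain ⟨w, hw⟩ : ∃ w, ρ' w ≠ 0 := by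
      by_contra! hcon
      exact hρ' (ContinuousLinearMap.ext hcon)
    exact ⟨(ρ' w)⁻¹ • w, by simp [hw]⟩
  -- With `ε‖v‖ ≤ 1/2`, the strict-derivative error absorbs only half of `τ`, leaving `τ/2 ≤ 2(‖ρ'‖
  -- + ε)t`; hence the choice of `K` below.
  set ε : ℝ := 1 / (2 * (‖v‖ + 1)) with hε
  have hvpos : 0 < ‖v‖ + 1 := by positivity
  have hεpos : 0 < ε := by positivity
  have hεv : ε * ‖v‖ ≤ 1 / 2 := by
    rw [hε, div_mul_eq_mul_div, one_mul, div_le_div_iff₀ (by positivity) (by norm_num)]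
    linarith
  have hO := hρ.isLittleO.def hεpos
  obtain ⟨r₁, hr₁, hO'⟩ := Metric.eventually_nhds_iff_ball.1 hO
  obtain ⟨r₂, hr₂, hS'⟩ := Metric.eventually_nhds_iff_ball.1 hS
  set r := min r₁ r₂
  have hr : 0 < r := lt_min hr₁ hr₂
  refine ⟨Metric.ball x₀ r, Metric.ball_mem_nhds _ hr, ?_⟩
  refine measure_thickening_le_of_transversal μ
    (Metric.isBounded_ball.subset inter_subset_right) v
    (K := 4 * (‖ρ'‖ + ε)) (by positivity) ?_
  rintro y ⟨hyS, hy⟩ z ⟨hzS, hz⟩ t ht τ hτ hyz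
  have hy0 : ρ y = 0 := hS' y (Metric.ball_subset_ball (min_le_right _ _) hy) hyS
  have hz0 : ρ z = 0 := hS' z (Metric.ball_subset_ball (min_le_right _ _) hz) hzS
  have hmem : (z, y) ∈ Metric.ball (x₀, x₀) r₁ := by
    rw [← ball_prod_same]
    exact ⟨Metric.ball_subset_ball (min_le_left _ _) hz,
      Metric.ball_subset_ball (min_le_left _ _) hy⟩
  have h1 := hO' _ hmem
  simp only [hy0, hz0, sub_zero, zero_sub, norm_neg] at h1
  set w := z - y - τ • v with hw
  have hzy : z - y = τ • v + w := by rw [hw]; abel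
  have h2 : ρ' (z - y) = τ + ρ' w := by rw [hzy]; simp [hv]
  have h3 : ‖z - y‖ ≤ τ * ‖v‖ + 2 * t := by
    rw [hzy]
    refine (norm_add_le _ _).trans ?_
    rw [norm_smul, Real.norm_of_nonneg hτ]
    linarith
  have h4 : |ρ' w| ≤ ‖ρ'‖ * (2 * t) :=
    (ρ'.le_opNorm w).trans (by gcongr)
  rw [h2, Real.norm_eq_abs] at h1
  have h5 := (abs_le.1 h4).1
  have h6 := le_abs_self (τ + ρ' w)
  have h7 : ε * ‖z - y‖ ≤ τ * (1 / 2) + ε * (2 * t) := by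
    calc ε * ‖z - y‖ ≤ ε * (τ * ‖v‖ + 2 * t) := by gcongr
      _ = τ * (ε * ‖v‖) + ε * (2 * t) := by ring
      _ ≤ _ := by gcongr
  nlinarith

end Thickening

theorem measure_thickening_le_of_isCompact {E : Type*} [PseudoMetricSpace E] [MeasurableSpace E]
    (μ : Measure E) {S : Set E} (hS : IsCompact S)
    (h : ∀ x ∈ S, ∃ V ∈ 𝓝 x, ∃ C : ℝ≥0∞, C ≠ ⊤ ∧ ∀ t : ℝ, 0 < t → t ≤ 1 →
      μ (Metric.thickening t (S ∩ V)) ≤ C * ENNReal.ofReal t) :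
    ∃ C : ℝ≥0∞, C ≠ ⊤ ∧ ∀ t : ℝ, 0 < t → t ≤ 1 →
      μ (Metric.thickening t S) ≤ C * ENNReal.ofReal t := by
  refine hS.induction_on (p := fun A => ∃ C : ℝ≥0∞, C ≠ ⊤ ∧ ∀ t : ℝ, 0 < t → t ≤ 1 →
      μ (Metric.thickening t A) ≤ C * ENNReal.ofReal t) ?_ ?_ ?_ ?_
  · exact ⟨0, by simp, by simp⟩
  · rintro A B hAB ⟨C, hC, h'⟩
    exact ⟨C, hC, fun t ht ht1 =>
      (measure_mono (Metric.thickening_subset_of_subset t hAB)).trans (h' t ht ht1)⟩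
  · rintro A B ⟨C, hC, hA⟩ ⟨D, hD, hB⟩
    refine ⟨C + D, by simp [hC, hD], fun t ht ht1 => ?_⟩
    rw [Metric.thickening_union, add_mul]
    exact (measure_union_le _ _).trans (add_le_add (hA t ht ht1) (hB t ht ht1))
  · intro x hx
    obtain ⟨V, hV, h'⟩ := h x hx
    exact ⟨S ∩ V, inter_mem_nhdsWithin S hV, h'⟩

/-! ### Boundary layers of a `C²` domain -/

section Domain

variable {N : ℕ} {Ω : Set (EuclideanSpace ℝ (Fin N))}

/-- The boundary of a bounded `C²` domain has neighbourhoods of volume `O(t)`. -/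
theorem IsBoundedC2Domain.volume_thickening_frontier_le (hΩ : IsBoundedC2Domain Ω) :
    ∃ C : ℝ≥0∞, C ≠ ⊤ ∧ ∀ t : ℝ, 0 < t → t ≤ 1 →
      volume (Metric.thickening t (frontier Ω)) ≤ C * ENNReal.ofReal t := by
  have hcpt : IsCompact (frontier Ω) :=
    (hΩ.isBounded.isCompact_closure).of_isClosed_subset isClosed_frontier frontier_subset_closure
  refine measure_thickening_le_of_isCompact volume hcpt fun x₀ hx₀ => ?_
  obtain ⟨U, ρ, hU, hxU, hρ, hρ', hΩU⟩ := hΩ.boundary_C2 x₀ hx₀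
  refine measure_thickening_le_of_hasStrictFDerivAt volume
    ((hρ.contDiffAt (hU.mem_nhds hxU)).hasStrictFDerivAt two_ne_zero) hρ' ?_
  filter_upwards [hU.mem_nhds hxU] with y hyU hy
  refine le_antisymm ?_ ?_
  · have hcl : y ∈ closure (Ω ∩ U) :=
      inter_comm U Ω ▸ IsOpen.inter_closure hU ⟨hyU, hy.1⟩
    have : ContinuousWithinAt ρ (Ω ∩ U) y :=
      (hρ.continuousOn y hyU).mono inter_subset_right
    have hm := this.mem_closure_image hcl
    have : closure (ρ '' (Ω ∩ U)) ⊆ Iic 0 := by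
      refine closure_minimal ?_ isClosed_Iic
      rintro _ ⟨z, hz, rfl⟩
      rw [hΩU] at hz
      exact hz.2.le
    exact this hm
  · by_contra! hneg
    have : y ∈ Ω ∩ U := by rw [hΩU]; exact ⟨hyU, hneg⟩
    rw [frontier, hΩ.isOpen.interior_eq] at hy
    exact hy.2 this.1

/-- Cutoffs built from the distance to `Ωᶜ` vanish outside `Ω` automatically, which the distance to
the boundary would not give. -/
theorem bdist_eq_infDist_compl (hΩ : Ω ≠ univ) {x : EuclideanSpace ℝ (Fin N)} (hx : x ∈ Ω)
    (ho : IsOpen Ω) : bdist Ω x = Metric.infDist x Ωᶜ := by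
  obtain ⟨y, hy, hxy⟩ := exists_mem_frontier_infDist_compl_eq_dist hx hΩ
  refine le_antisymm (hxy ▸ Metric.infDist_le_dist_of_mem hy) ?_
  refine Metric.infDist_le_infDist_of_subset ?_ ⟨y, hy⟩
  rw [frontier, ho.interior_eq]
  exact fun z hz => hz.2

end Domain

/-! ### Smooth cutoffs with controlled gradient -/

section Cutoff

open scoped Convolution

variable {E : Type*} [NormedAddCommGroup E] [NormedSpace ℝ E] [FiniteDimensional ℝ E]

/-- Mollification of a Lipschitz function with values in `[0, 1]`. -/
theorem exists_smooth_approx_of_lipschitz {g : E → ℝ} {L : NNReal} (hg : LipschitzWith L g)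
    (h0 : ∀ x, 0 ≤ g x) (h1 : ∀ x, g x ≤ 1) {r : ℝ} (hr : 0 < r) :
    ∃ χ : E → ℝ, ContDiff ℝ ∞ χ ∧ LipschitzWith L χ ∧ (∀ x, 0 ≤ χ x) ∧ (∀ x, χ x ≤ 1) ∧
      ∀ x c, (∀ y ∈ Metric.ball x r, g y = c) → χ x = c := by
  borelize E
  let μ : Measure E := Measure.addHaar
  let φ : ContDiffBump (0 : E) := ⟨r / 2, r, half_pos hr, half_lt_self hr⟩
  have hgc : Continuous g := hg.continuous
  have hint : ∀ x, Integrable (fun y => φ.normed μ y * g (x - y)) μ := fun x =>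
    (φ.continuous_normed.mul (by fun_prop)).integrable_of_hasCompactSupport
      φ.hasCompactSupport_normed.mul_right
  have hval : ∀ x, (φ.normed μ ⋆[ContinuousLinearMap.lsmul ℝ ℝ, μ] g) x =
      ∫ y, φ.normed μ y * g (x - y) ∂μ := fun x => rfl
  refine ⟨φ.normed μ ⋆[ContinuousLinearMap.lsmul ℝ ℝ, μ] g, ?_, ?_, ?_, ?_, ?_⟩
  · exact φ.hasCompactSupport_normed.contDiff_convolution_left _ (n := ⊤) φ.contDiff_normed
      hgc.locallyIntegrable
  · refine LipschitzWith.of_dist_le_mul fun x z => ?_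
    rw [hval, hval, Real.dist_eq, ← integral_sub (hint x) (hint z), ← Real.norm_eq_abs]
    have hb : ∀ y, ‖φ.normed μ y * g (x - y) - φ.normed μ y * g (z - y)‖ ≤
        φ.normed μ y * (L * dist x z) := by
      intro y
      rw [← mul_sub, norm_mul, Real.norm_of_nonneg (φ.nonneg_normed y)]
      refine mul_le_mul_of_nonneg_left ?_ (φ.nonneg_normed y)
      have := hg.dist_le_mul (x - y) (z - y)
      rwa [dist_sub_right, dist_eq_norm] at this
    refine (norm_integral_le_of_norm_le (φ.integrable_normed.mul_const _)
      (Eventually.of_forall hb)).trans (le_of_eq ?_)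
    rw [integral_mul_const, φ.integral_normed, one_mul]
  · intro x
    rw [hval]
    exact integral_nonneg fun y => mul_nonneg (φ.nonneg_normed y) (h0 _)
  · intro x
    rw [hval, ← φ.integral_normed (μ := μ)]
    exact integral_mono (hint x) φ.integrable_normed fun y =>
      mul_le_of_le_one_right (φ.nonneg_normed y) (h1 _)
  · intro x c hc
    have hx : g x = c := hc x (Metric.mem_ball_self hr)
    rw [φ.normed_convolution_eq_right (μ := μ) (x₀ := x) fun y hy => (hc y hy).trans hx.symm, hx]

/-- Smooth cutoff functions adapted to the distance to a set. -/
theorem exists_smooth_cutoff_infDist (S : Set E) {t : ℝ} (ht : 0 < t) :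
    ∃ χ : E → ℝ, ContDiff ℝ ∞ χ ∧ (∀ x, t ≤ Metric.infDist x S → χ x = 1) ∧
      (∀ x, Metric.infDist x S ≤ t / 2 → χ x = 0) ∧ (∀ x, ‖fderiv ℝ χ x‖ ≤ 4 / t) ∧
      ∀ x, (Metric.infDist x S ≤ t / 2 ∨ t ≤ Metric.infDist x S) → fderiv ℝ χ x = 0 := by
  -- The ramp runs from `5t/8` to `7t/8`, leaving a margin `t/8` inside `[t/2, t]` for mollification
  -- at radius `t/8`.
  let g : E → ℝ := fun x => max 0 (min 1 (4 / t * (Metric.infDist x S - 5 / 8 * t)))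
  have ht4 : 0 ≤ 4 / t := by positivity
  have hg : LipschitzWith (⟨4 / t, ht4⟩ : NNReal) g := by
    refine LipschitzWith.const_max (LipschitzWith.const_min ?_ 1) 0
    refine LipschitzWith.of_dist_le_mul fun x y => ?_
    have h := (Metric.lipschitz_infDist_pt S).dist_le_mul x y
    rw [Real.dist_eq] at h ⊢
    rw [← mul_sub, abs_mul, abs_of_nonneg ht4, sub_sub_sub_cancel_right]
    simp only [NNReal.coe_one, one_mul] at h
    exact mul_le_mul_of_nonneg_left h ht4
  obtain ⟨χ, hχ, hL, h0, h1, hc⟩ := exists_smooth_approx_of_lipschitz hg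
    (fun x => le_max_left _ _) (fun x => max_le zero_le_one (min_le_left _ _))
    (show 0 < t / 8 by positivity)
  have hball : ∀ x y, y ∈ Metric.ball x (t / 8) →
      |Metric.infDist y S - Metric.infDist x S| < t / 8 := by
    intro x y hy
    have h := (Metric.lipschitz_infDist_pt S).dist_le_mul y x
    rw [Real.dist_eq] at h
    simp only [NNReal.coe_one, one_mul] at h
    exact h.trans_lt hy
  have hone : ∀ x, t ≤ Metric.infDist x S → χ x = 1 := by
    refine fun x hx => hc x 1 fun y hy => ?_
    have := (abs_lt.1 (hball x y hy)).1
    have h' : 1 ≤ 4 / t * (Metric.infDist y S - 5 / 8 * t) := by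
      rw [div_mul_eq_mul_div, le_div_iff₀ ht]; linarith
    simp [g, h']
  have hzero : ∀ x, Metric.infDist x S ≤ t / 2 → χ x = 0 := by
    refine fun x hx => hc x 0 fun y hy => ?_
    have := (abs_lt.1 (hball x y hy)).2
    have h' : 4 / t * (Metric.infDist y S - 5 / 8 * t) ≤ 0 :=
      mul_nonpos_of_nonneg_of_nonpos ht4 (by linarith)
    simp only [g]
    exact max_eq_left ((min_le_right _ _).trans h')
  refine ⟨χ, hχ, hone, hzero, fun x => norm_fderiv_le_of_lipschitz ℝ hL, ?_⟩
  -- Since `0 ≤ χ ≤ 1`, points with value 0 or 1 are global extrema; this covers the end levels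
  -- `t/2` and `t` too.
  rintro x (hx | hx)
  · exact IsLocalMin.fderiv_eq_zero (Eventually.of_forall fun y => by
      rw [hzero x hx]; exact h0 y)
  · exact IsLocalMax.fderiv_eq_zero (Eventually.of_forall fun y => by
      rw [hone x hx]; exact h1 y)

end Cutoff

/-! ### Vanishing capacity and failure of Hardy's inequality -/

section Capacity

variable {N : ℕ} {Ω : Set (EuclideanSpace ℝ (Fin N))}

theorem IsBoundedC2Domain.ne_univ (hN : 1 ≤ N) (hΩ : IsBoundedC2Domain Ω) : Ω ≠ univ := by
  have : Nonempty (Fin N) := ⟨⟨0, hN⟩⟩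
  rintro rfl
  exact NormedSpace.unbounded_univ ℝ (EuclideanSpace ℝ (Fin N)) hΩ.isBounded

theorem norm_gradient_eq (u : EuclideanSpace ℝ (Fin N) → ℝ) (x : EuclideanSpace ℝ (Fin N)) :
    ‖gradient u x‖ = ‖fderiv ℝ u x‖ := by
  rw [gradient, LinearIsometryEquiv.norm_map]

theorem mem_CcSpace_of_eq_zero (hb : Bornology.IsBounded Ω)
    {k : ℕ∞} {u : EuclideanSpace ℝ (Fin N) → ℝ} (hu : ContDiff ℝ k u) {s : ℝ} (hs : 0 < s)
    (h : ∀ x, Metric.infDist x Ωᶜ ≤ s → u x = 0) : u ∈ CcSpace k Ω := by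
  have hcl : IsClosed {x | s ≤ Metric.infDist x Ωᶜ} :=
    isClosed_le continuous_const (Metric.continuous_infDist_pt _)
  have hsub : {x | s ≤ Metric.infDist x Ωᶜ} ⊆ Ω := by
    intro x hx
    by_contra hxΩ
    have h0 : Metric.infDist x Ωᶜ = 0 := Metric.infDist_zero_of_mem hxΩ
    have hx' : s ≤ Metric.infDist x Ωᶜ := hx
    linarith
  have hts : tsupport u ⊆ {x | s ≤ Metric.infDist x Ωᶜ} := by
    refine closure_minimal (fun x hx => ?_) hcl
    by_contra hlt
    exact hx (h x (not_le.1 hlt).le)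
  exact ⟨hu, (Metric.isCompact_of_isClosed_isBounded hcl (hb.subset hsub)).of_isClosed_subset
    (isClosed_tsupport u) hts, hts.trans hsub⟩

/-- The average of the cutoffs at the dyadic scales `a, a/2, …, a/2ⁿ⁻¹` has energy
`O(n^{1-p})`. -/
theorem IsBoundedC2Domain.exists_energy_le (hN : 1 ≤ N) (hΩ : IsBoundedC2Domain Ω) {p α : ℝ}
    (hp : 1 < p) (hα : 1 - 1 / p ≤ α) {a : ℝ} (ha : 0 < a) (ha1 : a ≤ 1) :
    ∃ C : ℝ≥0∞, C ≠ ⊤ ∧ ∀ n : ℕ, 0 < n → ∃ u ∈ CcSpace ⊤ Ω,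
      (∀ x ∈ Ω, a ≤ bdist Ω x → u x = 1) ∧
      weightedIntegral Ω p (α * p) (gradient u) ≤ C * ENNReal.ofReal ((n : ℝ) ^ (1 - p)) := by
  obtain ⟨C, hC, hvol⟩ := hΩ.volume_thickening_frontier_le
  have hne := hΩ.ne_univ hN
  have hp0 : 0 < p := by linarith
  have hαp : p - 1 ≤ α * p := by
    have := mul_le_mul_of_nonneg_right hα hp0.le
    rwa [sub_mul, one_mul, div_mul_cancel₀ _ hp0.ne'] at this
  let d : EuclideanSpace ℝ (Fin N) → ℝ := fun x => Metric.infDist x Ωᶜ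
  have hd : ∀ x ∈ Ω, bdist Ω x = d x := fun x hx => bdist_eq_infDist_compl hne hx hΩ.isOpen
  let t : ℕ → ℝ := fun j => a * (1 / 2) ^ j
  have ht : ∀ j, 0 < t j := fun j => by positivity
  have htsucc : ∀ j, t (j + 1) = t j / 2 := fun j => by simp only [t, pow_succ]; ring
  have htanti : Antitone t := antitone_nat_of_succ_le fun j => by
    rw [htsucc]; linarith [ht j]
  have ht0 : t 0 = a := by simp [t]
  have hta : ∀ j, t j ≤ a := fun j => ht0 ▸ htanti (Nat.zero_le j)
  choose χ hχ hone hzero hgrad hgrad0 using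
    fun j => exists_smooth_cutoff_infDist (Ωᶜ) (ht j)
  refine ⟨ENNReal.ofReal (4 ^ p) * C, ENNReal.mul_ne_top ENNReal.ofReal_ne_top hC,
    fun n hn => ?_⟩
  have hn0 : (0 : ℝ) < n := by exact_mod_cast hn
  let u : EuclideanSpace ℝ (Fin N) → ℝ := fun x => (n : ℝ)⁻¹ * ∑ j ∈ Finset.range n, χ j x
  have hu : ContDiff ℝ ∞ u :=
    contDiff_const.mul (ContDiff.sum fun j _ => hχ j)
  have hfd : ∀ x, fderiv ℝ u x = (n : ℝ)⁻¹ • ∑ j ∈ Finset.range n, fderiv ℝ (χ j) x := by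
    intro x
    have hdiff : ∀ j ∈ Finset.range n, DifferentiableAt ℝ (χ j) x := fun j _ =>
      (hχ j).differentiable (by simp) x
    simp only [u]
    rw [fderiv_const_mul (DifferentiableAt.fun_sum hdiff), fderiv_fun_sum hdiff]
  refine ⟨u, mem_CcSpace_of_eq_zero hΩ.isBounded hu (ht n) ?_, ?_, ?_⟩
  · intro x hx
    simp only [u]
    rw [Finset.sum_eq_zero, mul_zero]
    intro j hj
    exact hzero j x (hx.trans (htsucc j ▸ htanti (Finset.mem_range.1 hj)))
  · intro x hx hax
    rw [hd x hx] at hax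
    simp only [u]
    rw [Finset.sum_congr rfl fun j _ => hone j x ((hta j).trans hax)]
    simp [hn0.ne']
  let S : ℕ → Set (EuclideanSpace ℝ (Fin N)) := fun j => Metric.thickening (t j) (frontier Ω)
  have hSm : ∀ j, MeasurableSet (S j) := fun j => Metric.isOpen_thickening.measurableSet
  let c : ℕ → ℝ := fun j => ((n : ℝ)⁻¹ * (4 / t j)) ^ p * t j ^ (α * p)
  have hpt : ∀ x ∈ Ω, ENNReal.ofReal (‖gradient u x‖ ^ p * bdist Ω x ^ (α * p)) ≤
      ∑ j ∈ Finset.range n, (S j).indicator (fun _ => ENNReal.ofReal (c j)) x := by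
    intro x hx
    rw [norm_gradient_eq, hd x hx]
    -- The open dyadic layers are disjoint, so at most one cutoff has nonzero gradient at `x`.
    by_cases hex : ∃ k ∈ Finset.range n, t k / 2 < d x ∧ d x < t k
    · obtain ⟨k, hk, hk1, hk2⟩ := hex
      have hfdk : fderiv ℝ u x = (n : ℝ)⁻¹ • fderiv ℝ (χ k) x := by
        rw [hfd, Finset.sum_eq_single_of_mem k hk]
        intro j _ hjk
        refine hgrad0 j x ?_
        rcases lt_or_gt_of_ne hjk with h | h
        · exact Or.inl (hk2.le.trans (htsucc j ▸ htanti h))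
        · exact Or.inr ((htanti h).trans ((htsucc k).le.trans hk1.le))
      have hxS : x ∈ S k := by
        obtain ⟨y, hy, hxy⟩ := exists_mem_frontier_infDist_compl_eq_dist hx hne
        exact Metric.mem_thickening_iff.2 ⟨y, hy, hxy ▸ hk2⟩
      refine le_trans ?_ (Finset.single_le_sum (f := fun j =>
        (S j).indicator (fun _ => ENNReal.ofReal (c j)) x) (fun j _ => zero_le) hk)
      simp only [indicator_of_mem hxS]
      refine ENNReal.ofReal_le_ofReal ?_
      have hdx : 0 ≤ d x := Metric.infDist_nonneg
      have hαp0 : 0 ≤ α * p := by linarith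
      have hb : ‖fderiv ℝ u x‖ ≤ (n : ℝ)⁻¹ * (4 / t k) := by
        rw [hfdk, norm_smul, norm_inv, Real.norm_natCast]
        have := hgrad k x
        gcongr
      have := (ht k).le
      simp only [c]
      gcongr
    · have hz : fderiv ℝ u x = 0 := by
        rw [hfd, Finset.sum_eq_zero, smul_zero]
        intro j hj
        refine hgrad0 j x ?_
        by_contra! hcon
        exact hex ⟨j, hj, hcon⟩
      simp [hz, Real.zero_rpow hp0.ne']
  -- The lower bound on `α` enters here: the remaining power `t j ^ (αp - p + 1)` has nonnegative
  -- exponent and base at most 1.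
  have hcj : ∀ j, c j * t j ≤ 4 ^ p * (n : ℝ) ^ (-p) := by
    intro j
    have htj := ht j
    have e : c j * t j = 4 ^ p * (n : ℝ) ^ (-p) * t j ^ (-p + α * p + 1) := by
      simp only [c]
      rw [Real.rpow_add htj, Real.rpow_add htj, Real.rpow_one, Real.mul_rpow (by positivity)
        (by positivity), Real.div_rpow (by norm_num) htj.le, Real.inv_rpow hn0.le,
        Real.rpow_neg hn0.le, Real.rpow_neg htj.le]
      ring
    rw [e]
    refine mul_le_of_le_one_right (by positivity) ?_
    exact Real.rpow_le_one htj.le ((hta j).trans ha1) (by linarith)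
  calc weightedIntegral Ω p (α * p) (gradient u)
      ≤ ∫⁻ x in Ω, ∑ j ∈ Finset.range n,
          (S j).indicator (fun _ => ENNReal.ofReal (c j)) x :=
        setLIntegral_mono' hΩ.isOpen.measurableSet hpt
    _ = ∑ j ∈ Finset.range n, ENNReal.ofReal (c j) * (volume.restrict Ω) (S j) := by
        rw [lintegral_finsetSum _ fun j _ => measurable_const.indicator (hSm j)]
        exact Finset.sum_congr rfl fun j _ => lintegral_indicator_const (hSm j) _
    _ ≤ ∑ j ∈ Finset.range n, C * ENNReal.ofReal (4 ^ p * (n : ℝ) ^ (-p)) := by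
        refine Finset.sum_le_sum fun j _ => ?_
        calc ENNReal.ofReal (c j) * (volume.restrict Ω) (S j)
            ≤ ENNReal.ofReal (c j) * (C * ENNReal.ofReal (t j)) := by
              gcongr
              exact (Measure.restrict_apply_le _ _).trans
                (hvol _ (ht j) ((hta j).trans ha1))
          _ = C * ENNReal.ofReal (c j * t j) := by
              rw [ENNReal.ofReal_mul' (ht j).le]; ring
          _ ≤ _ := mul_le_mul' le_rfl (ENNReal.ofReal_le_ofReal (hcj j))
    _ = ENNReal.ofReal (4 ^ p) * C * ENNReal.ofReal ((n : ℝ) ^ (1 - p)) := by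
        rw [Finset.sum_const, Finset.card_range, nsmul_eq_mul, sub_eq_add_neg,
          Real.rpow_add hn0, Real.rpow_one, ENNReal.ofReal_mul hn0.le,
          ENNReal.ofReal_mul (by positivity), ENNReal.ofReal_natCast]
        ring

/-- For `α ≥ 1 - 1/p`, inner parallel sets have zero weighted capacity. -/
theorem IsBoundedC2Domain.exists_energy_lt (hN : 1 ≤ N) (hΩ : IsBoundedC2Domain Ω) {p α : ℝ}
    (hp : 1 < p) (hα : 1 - 1 / p ≤ α) {η : ℝ} (hη : 0 < η) {ε : ℝ≥0∞} (hε : 0 < ε) :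
    ∃ u ∈ CcSpace ⊤ Ω, (∀ x ∈ Ω, η ≤ bdist Ω x → u x = 1) ∧
      weightedIntegral Ω p (α * p) (gradient u) < ε := by
  obtain ⟨C, hC, h⟩ := hΩ.exists_energy_le hN hp hα (lt_min hη one_pos) (min_le_right η 1)
  have hlim : Tendsto (fun n : ℕ => C * ENNReal.ofReal ((n : ℝ) ^ (1 - p))) atTop (𝓝 0) := by
    have h1 : Tendsto (fun n : ℕ => (n : ℝ) ^ (1 - p)) atTop (𝓝 0) := by
      have := (tendsto_rpow_neg_atTop (show 0 < p - 1 by linarith)).comp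
        tendsto_natCast_atTop_atTop
      simpa [Function.comp_def] using this
    have h2 := ENNReal.Tendsto.const_mul (ENNReal.tendsto_ofReal h1) (Or.inr hC)
    simpa using h2
  obtain ⟨n, hn, hn0⟩ := ((hlim.eventually (gt_mem_nhds hε)).and (eventually_gt_atTop 0)).exists
  obtain ⟨u, hu, hu1, hle⟩ := h n hn0
  exact ⟨u, hu, fun x hx hηx => hu1 x hx ((min_le_left _ _).trans hηx), hle.trans_lt hn⟩

theorem memW0_of_mem_CcSpace {p α : ℝ} (hp : 0 < p) {u : EuclideanSpace ℝ (Fin N) → ℝ}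
    (hu : u ∈ CcSpace ⊤ Ω) : MemW0 Ω p α u (gradient u) := by
  have hgc : Continuous (gradient u) :=
    (LinearIsometryEquiv.continuous _).comp (hu.1.continuous_fderiv (by simp))
  refine ⟨hu.1.continuous.aestronglyMeasurable, hgc.aestronglyMeasurable, fun _ => u,
    fun _ => hu, ?_⟩
  have hp' : 0 < p⁻¹ := inv_pos.2 hp
  have : sobolevNorm Ω p α (u - u) (gradient u - gradient u) = 0 := by
    simp [sobolevNorm, weightedIntegral, Real.zero_rpow hp.ne', ENNReal.zero_rpow_of_pos hp']
  simp only [this]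
  exact tendsto_const_nhds

/-- A test function equal to 1 on a fixed nonempty open `V` makes the Hardy side at least `μ * A >
0`, while its energy can be taken below `μ * A`. -/
theorem IsBoundedC2Domain.not_hardyInequality (hN : 1 ≤ N) (hΩ : IsBoundedC2Domain Ω) {p α : ℝ}
    (hp : 1 < p) (hα : 1 - 1 / p ≤ α) : ¬ HardyInequality Ω p α := by
  rintro ⟨μ, hμ, hH⟩
  obtain ⟨x₀, hx₀⟩ := hΩ.isConnected.nonempty
  have hne := hΩ.ne_univ hN
  have hcont : Continuous (bdist Ω) := Metric.continuous_infDist_pt _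
  have hpos : 0 < bdist Ω x₀ := by
    rw [bdist_eq_infDist_compl hne hx₀ hΩ.isOpen]
    exact (hΩ.isOpen.isClosed_compl.notMem_iff_infDist_pos (nonempty_compl.2 hne)).1
      (not_not.2 hx₀)
  set η := bdist Ω x₀ / 2 with hη
  have hη0 : 0 < η := half_pos hpos
  let V := Ω ∩ {x | η < bdist Ω x}
  have hVo : IsOpen V := hΩ.isOpen.inter (isOpen_lt continuous_const hcont)
  have hVne : V.Nonempty := ⟨x₀, hx₀, half_lt_self hpos⟩
  set A : ℝ≥0∞ := ∫⁻ x in V, ENNReal.ofReal (bdist Ω x ^ (p * (α - 1))) with hA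
  have hmeas : Measurable fun x => ENNReal.ofReal (bdist Ω x ^ (p * (α - 1))) :=
    (hcont.measurable.pow_const _).ennreal_ofReal
  have hA0 : 0 < A := by
    rw [hA, setLIntegral_pos_iff hmeas]
    refine (hVo.measure_pos volume hVne).trans_le (measure_mono fun x hx => ⟨?_, hx⟩)
    have hx2 : η < bdist Ω x := hx.2
    simpa using Real.rpow_pos_of_pos (hη0.trans hx2) _
  obtain ⟨u, hu, hu1, hlt⟩ := hΩ.exists_energy_lt hN hp hα hη0
    (ENNReal.mul_pos (ENNReal.ofReal_pos.2 hμ).ne' hA0.ne')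
  refine absurd (hH u _ (memW0_of_mem_CcSpace (by linarith) hu)) (not_le.2 (hlt.trans_le ?_))
  gcongr
  calc A = ∫⁻ x in V, ENNReal.ofReal (‖u x‖ ^ p * bdist Ω x ^ (p * (α - 1))) := by
        refine setLIntegral_congr_fun hVo.measurableSet fun x hx => ?_
        have hx2 : η < bdist Ω x := hx.2
        simp [hu1 x hx.1 hx2.le]
    _ ≤ _ := lintegral_mono_set inter_subset_left

end Capacity

end WeightedHardy

theorem proposition2p2 (N : ℕ) (hN : 1 ≤ N) (Ω : Set (EuclideanSpace ℝ (Fin N)))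
    (hΩ : WeightedHardy.IsBoundedC2Domain Ω) (p α : ℝ) (hp : 1 < p) (hα : 1 - 1 / p ≤ α) :
    (∀ η ∈ Set.Ioo (0 : ℝ) (sSup (WeightedHardy.bdist Ω '' Ω)),
      IsGLB {I : ℝ≥0∞ | ∃ u ∈ WeightedHardy.CcSpace 1 Ω,
        (∀ x ∈ Ω, WeightedHardy.bdist Ω x = η → u x = 1) ∧
        I = WeightedHardy.weightedIntegral Ω p (α * p) (gradient u)} 0) ∧
    ¬ WeightedHardy.HardyInequality Ω p α := by
  refine ⟨fun η hη => ⟨fun _ _ => zero_le, fun b hb => ?_⟩, hΩ.not_hardyInequality hN hp hα⟩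
  by_contra hb0
  obtain ⟨u, hu, hu1, hlt⟩ := hΩ.exists_energy_lt hN hp hα hη.1 (not_le.1 hb0)
  exact absurd (hb ⟨u, ⟨hu.1.of_le (by exact_mod_cast le_top), hu.2⟩,
    fun x hx hxη => hu1 x hx hxη.ge, rfl⟩) (not_le.2 hlt)
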